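/- Let $L$ be a lattice. A congruence relation $\Theta$ of $L$ is called \emph{uniform} if any two congruence classes of $\Theta$ have the same cardinality, and \emph{regular} if any congruence class of $\Theta$ determines $\Theta$, that is, every congruence of $L$ having a class in common with $\Theta$ equals $\Theta$. The lattice $L$ is called \emph{uniform} (respectively \emph{regular}) if all of its congruences are uniform (respectively regular). The congruence lattice $\operatorname{Con} L$ is the lattice of all congruences of $L$, ordered by inclusion. \textbf{Theorem} (Grätzer--Schmidt--Thomsen, 2002). For every finite (nonempty) distributive lattice $D$ there is a finite (nonempty) uniform lattice $L$ whose congruence lattice $\operatorname{Con} L$ is isomorphic to $D$. Moreover, every finite uniform lattice is regular; in particular, the lattice $L$ can be chosen to be both uniform and regular. -/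

import Mathlib

universe u v

namespace LatticeCon

/-- Congruences of a lattice are ordered by inclusion: `θ ≤ ψ` iff `θ x y → ψ x y`. -/
instance instPartialOrder {α : Type u} [Lattice α] : PartialOrder (LatticeCon α) where
  le θ ψ := ∀ ⦃x y : α⦄, θ.r x y → ψ.r x y
  le_refl _ _ _ h := h
  le_trans _ _ _ h₁ h₂ _ _ h := h₂ (h₁ h)
  le_antisymm θ ψ h₁ h₂ := by
    have h : θ.toSetoid = ψ.toSetoid := Setoid.ext fun _ _ => ⟨fun h => h₁ h, fun h => h₂ h⟩
    cases θ
    cases ψ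
    cases h
    rfl

/-- The infimum of a set of congruences is their intersection. -/
instance instInfSet {α : Type u} [Lattice α] : InfSet (LatticeCon α) where
  sInf S :=
    { r := fun x y => ∀ θ ∈ S, θ.r x y
      iseqv :=
        { refl := fun x θ _ => θ.iseqv.refl x
          symm := fun h θ hθ => θ.iseqv.symm (h θ hθ)
          trans := fun h₁ h₂ θ hθ => θ.iseqv.trans (h₁ θ hθ) (h₂ θ hθ) }
      inf := fun h₁ h₂ θ hθ => θ.inf (h₁ θ hθ) (h₂ θ hθ)
      sup := fun h₁ h₂ θ hθ => θ.sup (h₁ θ hθ) (h₂ θ hθ) }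

/-- The congruence lattice `Con α` of a lattice `α`: the (complete) lattice of all congruences,
ordered by inclusion. -/
instance instCompleteLattice {α : Type u} [Lattice α] : CompleteLattice (LatticeCon α) :=
  completeLatticeOfInf (LatticeCon α) fun _ =>
    ⟨fun θ hθ _ _ h => h θ hθ, fun _ hψ _ _ h θ hθ => hψ hθ h⟩

/-- A congruence is uniform if any two of its classes have the same cardinality. -/
def IsUniform {α : Type u} [Lattice α] (θ : LatticeCon α) : Prop :=
  ∀ A ∈ θ.toSetoid.classes, ∀ B ∈ θ.toSetoid.classes, Cardinal.mk A = Cardinal.mk B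

/-- A congruence is regular if any one of its classes determines it: a congruence that has
a class in common with it is equal to it. -/
def IsRegular {α : Type u} [Lattice α] (θ : LatticeCon α) : Prop :=
  ∀ A ∈ θ.toSetoid.classes, ∀ ψ : LatticeCon α, A ∈ ψ.toSetoid.classes → ψ = θ

end LatticeCon

/-- A lattice is uniform if all of its congruences are uniform. -/
def IsUniformLattice (α : Type u) [Lattice α] : Prop :=
  ∀ θ : LatticeCon α, θ.IsUniform

/-- A lattice is regular if all of its congruences are regular. -/
def IsRegularLattice (α : Type u) [Lattice α] : Prop :=
  ∀ θ : LatticeCon α, θ.IsRegular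

/-! Induct on the size of `D`. For an atom `p` and the largest `q` with `p ⊓ q = ⊥`, distributivity
makes `d` recoverable from `p ⊔ d` and the truth of `p ≤ d`; the only constraint is `p ⊔ d ≤ p ⊔ q`
when `p ≰ d` (`decompositionOrderIso`). By induction `Set.Ici p` is the congruence lattice of a
uniform `A`; let `α` be the congruence matching `p ⊔ q`. The order on `FibredProd α B`, with `B`
simple and having an interior element, forces any congruence whose base part is not below `α` to
collapse all fibres. So its congruences are pairs `(θ, e)` with `θ ≤ α` unless `e` (`conOrderIso`),
which is the same description. The classes are products, so uniformity persists. Regularity comes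
from counting: intersect two congruences that share a class. -/

namespace LatticeCon

/-! ### Finite uniform lattices are regular -/

section Basic

variable {α : Type u} [Lattice α]

theorem r_left_of_le_of_le (θ : LatticeCon α) {x y z : α} (hxy : x ≤ y) (hyz : y ≤ z)
    (h : θ.r x z) : θ.r x y := by
  simpa [inf_eq_left.2 hxy, inf_eq_right.2 hyz] using θ.inf h (θ.iseqv.refl y)

theorem isUniform_iff (θ : LatticeCon α) :
    θ.IsUniform ↔ ∀ x y, Cardinal.mk {z // θ.r z x} = Cardinal.mk {z // θ.r z y} := by
  constructor
  · intro h x y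
    exact h _ (θ.toSetoid.mem_classes x) _ (θ.toSetoid.mem_classes y)
  · rintro h _ ⟨x, rfl⟩ _ ⟨y, rfl⟩
    exact h x y

/-- The shared class is also a class of `φ = θ ∩ ψ`. By uniformity all classes of `φ` and `θ` then
have one finite size, so each inclusion of a `φ`-class in a `θ`-class is an equality. -/
theorem le_of_mem_classes [Finite α] (h : IsUniformLattice α) {θ ψ : LatticeCon α} {A : Set α}
    (hθ : A ∈ θ.toSetoid.classes) (hψ : A ∈ ψ.toSetoid.classes) : θ ≤ ψ := by
  let φ : LatticeCon α :=
    { r := fun x y => θ.r x y ∧ ψ.r x y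
      iseqv :=
        { refl := fun x => ⟨θ.iseqv.refl x, ψ.iseqv.refl x⟩
          symm := fun h => ⟨θ.iseqv.symm h.1, ψ.iseqv.symm h.2⟩
          trans := fun h₁ h₂ => ⟨θ.iseqv.trans h₁.1 h₂.1, ψ.iseqv.trans h₁.2 h₂.2⟩ }
      inf := fun h₁ h₂ => ⟨θ.inf h₁.1 h₂.1, ψ.inf h₁.2 h₂.2⟩
      sup := fun h₁ h₂ => ⟨θ.sup h₁.1 h₂.1, ψ.sup h₁.2 h₂.2⟩ }
  obtain ⟨a, ha⟩ := hθ
  obtain ⟨b, hb⟩ := hψ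
  have hab : ψ.r a b := by
    have : a ∈ A := by rw [ha]; exact θ.iseqv.refl a
    rw [hb] at this
    exact this
  have hA : {z | φ.r z a} = {z | θ.r z a} := by
    ext z
    refine ⟨fun hz => hz.1, fun hz => ⟨hz, ?_⟩⟩
    have : z ∈ A := by rw [ha]; exact hz
    rw [hb] at this
    exact ψ.iseqv.trans this (ψ.iseqv.symm hab)
  intro x y hxy
  have hcard : Nat.card {z | φ.r z y} = Nat.card {z | θ.r z y} := by
    have h₁ := (isUniform_iff φ).1 (h φ) y a
    have h₂ := (isUniform_iff θ).1 (h θ) a y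
    refine congrArg Cardinal.toNat (h₁.trans (Eq.trans ?_ h₂))
    exact congrArg (fun s : Set α => Cardinal.mk s) hA
  have hsub : {z | φ.r z y} ⊆ {z | θ.r z y} := fun z hz => hz.1
  have heq := Set.eq_of_subset_of_ncard_le hsub hcard.ge (Set.toFinite _)
  have hx : x ∈ {z | φ.r z y} := by rw [heq]; exact hxy
  exact hx.2

end Basic

/-- A bounded lattice is simple if every congruence identifying two distinct elements identifies
the bounds. -/
def IsSimpleLattice (B : Type v) [Lattice B] [BoundedOrder B] : Prop :=
  ∀ θ : LatticeCon B, ∀ x y, x ≠ y → θ.r x y → θ.r ⊥ ⊤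

end LatticeCon

theorem IsUniformLattice.isRegularLattice {α : Type u} [Lattice α] [Finite α]
    (h : IsUniformLattice α) : IsRegularLattice α := fun _ _ hA _ hψ =>
  le_antisymm (LatticeCon.le_of_mem_classes h hψ hA) (LatticeCon.le_of_mem_classes h hA hψ)

/-! ### The fibred product as a lattice -/

/-- The fibred product of `A` and `B` along a congruence `α` of `A`: the elements of `A × B`, where
elements strictly inside the `B`-fibres are comparable only over a common class of `α`. -/
@[ext]
structure FibredProd {A : Type u} [Lattice A] (α : LatticeCon A) (B : Type v) where
  fst : A
  snd : B

namespace FibredProd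

variable {A : Type u} [Lattice A] {α : LatticeCon A} {B : Type v} [Lattice B] [BoundedOrder B]

instance instPartialOrder : PartialOrder (FibredProd α B) where
  le x y := x.fst ≤ y.fst ∧ x.snd ≤ y.snd ∧ (x.snd = ⊥ ∨ y.snd = ⊤ ∨ α.r x.fst y.fst)
  le_refl x := ⟨le_rfl, le_rfl, .inr (.inr (α.iseqv.refl _))⟩
  le_trans x y z := by
    rintro ⟨h₁, h₂, h₃⟩ ⟨k₁, k₂, k₃⟩
    refine ⟨h₁.trans k₁, h₂.trans k₂, ?_⟩
    rcases h₃ with h | h | h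
    · exact .inl h
    · exact .inr (.inl (top_le_iff.1 (h ▸ k₂)))
    · rcases k₃ with k | k | k
      · exact .inl (le_bot_iff.1 (k ▸ h₂))
      · exact .inr (.inl k)
      · exact .inr (.inr (α.iseqv.trans h k))
  le_antisymm x y h k := FibredProd.ext (h.1.antisymm k.1) (h.2.1.antisymm k.2.1)

theorem le_def {x y : FibredProd α B} : x ≤ y ↔
    x.fst ≤ y.fst ∧ x.snd ≤ y.snd ∧ (x.snd = ⊥ ∨ y.snd = ⊤ ∨ α.r x.fst y.fst) := Iff.rfl

open Classical in
/-- The join in a fibred product. -/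
noncomputable def sup (x y : FibredProd α B) : FibredProd α B where
  fst := x.fst ⊔ y.fst
  snd := if (x.snd = ⊥ ∨ α.r x.fst (x.fst ⊔ y.fst)) ∧ (y.snd = ⊥ ∨ α.r y.fst (x.fst ⊔ y.fst))
    then x.snd ⊔ y.snd else ⊤

open Classical in
/-- The meet in a fibred product. -/
noncomputable def inf (x y : FibredProd α B) : FibredProd α B where
  fst := x.fst ⊓ y.fst
  snd := if (x.snd = ⊤ ∨ α.r (x.fst ⊓ y.fst) x.fst) ∧ (y.snd = ⊤ ∨ α.r (x.fst ⊓ y.fst) y.fst)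
    then x.snd ⊓ y.snd else ⊥

noncomputable instance instLattice : Lattice (FibredProd α B) where
  sup := sup
  inf := inf
  le_sup_left x y := by
    simp only [le_def, sup]
    split_ifs with h
    · exact ⟨le_sup_left, le_sup_left, by tauto⟩
    · exact ⟨le_sup_left, le_top, .inr (.inl rfl)⟩
  le_sup_right x y := by
    simp only [le_def, sup]
    split_ifs with h
    · exact ⟨le_sup_right, le_sup_right, by tauto⟩
    · exact ⟨le_sup_right, le_top, .inr (.inl rfl)⟩
  sup_le x y z := by
    rintro ⟨h₁, h₂, h₃⟩ ⟨k₁, k₂, k₃⟩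
    refine le_def.2 ⟨sup_le h₁ k₁, ?_⟩
    simp only [sup]
    -- An upper bound with second coordinate below `⊤` rules out the jump to `⊤` in `sup`.
    by_cases hz : z.snd = ⊤
    · exact ⟨le_top.trans_eq hz.symm, .inr (.inl hz)⟩
    have hx : x.snd = ⊥ ∨ α.r x.fst (x.fst ⊔ y.fst) := by
      rcases h₃ with h | h | h
      · exact .inl h
      · exact absurd h hz
      · exact .inr (α.r_left_of_le_of_le le_sup_left (sup_le h₁ k₁) h)
    have hy : y.snd = ⊥ ∨ α.r y.fst (x.fst ⊔ y.fst) := by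
      rcases k₃ with h | h | h
      · exact .inl h
      · exact absurd h hz
      · exact .inr (α.r_left_of_le_of_le le_sup_right (sup_le h₁ k₁) h)
    rw [if_pos ⟨hx, hy⟩]
    refine ⟨sup_le h₂ k₂, ?_⟩
    rcases hx with hx | hx
    · rcases hy with hy | hy
      · left; simp [hx, hy]
      · rcases k₃ with h | h | h
        · left; simp [hx, h]
        · exact absurd h hz
        · exact .inr (.inr (α.iseqv.trans (α.iseqv.symm hy) h))
    · rcases h₃ with h | h | h
      · rcases hy with hy | hy
        · left; simp [h, hy]
        · rcases k₃ with k | k | k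
          · left; simp [h, k]
          · exact absurd k hz
          · exact .inr (.inr (α.iseqv.trans (α.iseqv.symm hy) k))
      · exact absurd h hz
      · exact .inr (.inr (α.iseqv.trans (α.iseqv.symm hx) h))
  inf_le_left x y := by
    simp only [le_def, inf]
    split_ifs with h
    · refine ⟨inf_le_left, inf_le_left, by tauto⟩
    · exact ⟨inf_le_left, bot_le, .inl rfl⟩
  inf_le_right x y := by
    simp only [le_def, inf]
    split_ifs with h
    · refine ⟨inf_le_right, inf_le_right, by tauto⟩
    · exact ⟨inf_le_right, bot_le, .inl rfl⟩
  le_inf z x y := by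
    rintro ⟨h₁, h₂, h₃⟩ ⟨k₁, k₂, k₃⟩
    refine le_def.2 ⟨le_inf h₁ k₁, ?_⟩
    simp only [inf]
    by_cases hz : z.snd = ⊥
    · exact ⟨hz.trans_le bot_le, .inl hz⟩
    have hz₁ : x.snd ≠ ⊤ → α.r z.fst (x.fst ⊓ y.fst) := fun hx =>
      α.r_left_of_le_of_le (le_inf h₁ k₁) inf_le_left (by tauto)
    have hz₂ : y.snd ≠ ⊤ → α.r z.fst (x.fst ⊓ y.fst) := fun hx =>
      α.r_left_of_le_of_le (le_inf h₁ k₁) inf_le_right (by tauto)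
    have hx : x.snd = ⊤ ∨ α.r (x.fst ⊓ y.fst) x.fst := or_iff_not_imp_left.2 fun hx =>
      α.iseqv.trans (α.iseqv.symm (hz₁ hx)) (by tauto)
    have hy : y.snd = ⊤ ∨ α.r (x.fst ⊓ y.fst) y.fst := or_iff_not_imp_left.2 fun hx =>
      α.iseqv.trans (α.iseqv.symm (hz₂ hx)) (by tauto)
    rw [if_pos ⟨hx, hy⟩]
    refine ⟨le_inf h₂ k₂, .inr ?_⟩
    by_cases h : x.snd = ⊤
    · by_cases k : y.snd = ⊤
      · left; simp [h, k]
      · exact .inr (hz₂ k)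
    · exact .inr (hz₁ h)

theorem snd_sup (x y : FibredProd α B) (hx : x.snd = ⊥ ∨ α.r x.fst (x.fst ⊔ y.fst))
    (hy : y.snd = ⊥ ∨ α.r y.fst (x.fst ⊔ y.fst)) : (x ⊔ y).snd = x.snd ⊔ y.snd :=
  if_pos ⟨hx, hy⟩

theorem snd_inf (x y : FibredProd α B) (hx : x.snd = ⊤ ∨ α.r (x.fst ⊓ y.fst) x.fst)
    (hy : y.snd = ⊤ ∨ α.r (x.fst ⊓ y.fst) y.fst) : (x ⊓ y).snd = x.snd ⊓ y.snd :=
  if_pos ⟨hx, hy⟩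

theorem mk_sup_mk_of_rel {a a' : A} (b b' : B) (h : α.r a a') :
    (⟨a, b⟩ ⊔ ⟨a', b'⟩ : FibredProd α B) = ⟨a ⊔ a', b ⊔ b'⟩ := by
  refine FibredProd.ext rfl (snd_sup _ _ (.inr ?_) (.inr ?_))
  · simpa using α.sup (α.iseqv.refl a) h
  · simpa using α.sup (α.iseqv.symm h) (α.iseqv.refl a')

theorem mk_inf_mk_of_rel {a a' : A} (b b' : B) (h : α.r a a') :
    (⟨a, b⟩ ⊓ ⟨a', b'⟩ : FibredProd α B) = ⟨a ⊓ a', b ⊓ b'⟩ := by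
  refine FibredProd.ext rfl (snd_inf _ _ (.inr ?_) (.inr ?_))
  · simpa using α.inf (α.iseqv.refl a) (α.iseqv.symm h)
  · simpa using α.inf h (α.iseqv.refl a')

theorem mk_sup_mk_of_le {a a' : A} (b : B) (h : a ≤ a') :
    (⟨a, ⊥⟩ ⊔ ⟨a', b⟩ : FibredProd α B) = ⟨a', b⟩ :=
  sup_eq_right.2 (le_def.2 ⟨h, bot_le, .inl rfl⟩)

theorem mk_inf_mk_of_le {a a' : A} (b : B) (h : a ≤ a') :
    (⟨a, b⟩ ⊓ ⟨a', ⊤⟩ : FibredProd α B) = ⟨a, b⟩ :=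
  inf_eq_left.2 (le_def.2 ⟨h, le_top, .inr (.inl rfl)⟩)

theorem mk_bot_sup_mk_bot (a a' : A) :
    (⟨a, ⊥⟩ ⊔ ⟨a', ⊥⟩ : FibredProd α B) = ⟨a ⊔ a', ⊥⟩ :=
  FibredProd.ext rfl ((snd_sup _ _ (.inl rfl) (.inl rfl)).trans (by simp))

theorem inf_mk_bot (x : FibredProd α B) (a : A) : x ⊓ ⟨a, ⊥⟩ = ⟨x.fst ⊓ a, ⊥⟩ :=
  FibredProd.ext rfl (le_bot_iff.1 (le_def.1 (inf_le_right : x ⊓ ⟨a, ⊥⟩ ≤ ⟨a, ⊥⟩)).2.1)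

theorem sup_mk_top (x : FibredProd α B) (a : A) : x ⊔ ⟨a, ⊤⟩ = ⟨x.fst ⊔ a, ⊤⟩ :=
  FibredProd.ext rfl (top_le_iff.1 (le_def.1 (le_sup_right : ⟨a, ⊤⟩ ≤ x ⊔ ⟨a, ⊤⟩)).2.1)

/-- This jump to `⊤` is how a base relation outside `α` reaches the fibres. -/
theorem mk_bot_sup_mk_of_not_rel {a a' : A} {b : B} (h : a ≤ a') (hα : ¬ α.r a a') (hb : b ≠ ⊥) :
    (⟨a', ⊥⟩ ⊔ ⟨a, b⟩ : FibredProd α B) = ⟨a', ⊤⟩ := by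
  refine FibredProd.ext (sup_eq_left.2 h) (if_neg ?_)
  rintro ⟨-, hb' | hα'⟩
  · exact hb hb'
  · exact hα (by simpa [sup_eq_left.2 h] using hα')

/-! ### Congruences of the fibred product -/

/-- The congruence of a fibred product given by a congruence `θ` of the base, which identifies all
elements in a fibre if `e` holds. -/
def con (θ : LatticeCon A) (e : Prop) (he : ¬ e → θ ≤ α) : LatticeCon (FibredProd α B) where
  r x y := θ.r x.fst y.fst ∧ (e ∨ x.snd = y.snd)
  iseqv :=
    { refl x := ⟨θ.iseqv.refl _, .inr rfl⟩
      symm h := ⟨θ.iseqv.symm h.1, h.2.imp id Eq.symm⟩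
      trans h k := ⟨θ.iseqv.trans h.1 k.1, by
        rcases h.2 with h | h
        · exact .inl h
        · exact h ▸ k.2⟩ }
  inf {w x y z} h k := by
    refine ⟨θ.inf h.1 k.1, or_iff_not_imp_left.2 fun hne => ?_⟩
    have h₁ := he hne h.1
    have k₁ := he hne k.1
    have m₁ := α.inf h₁ k₁
    have h₂ := h.2.resolve_left hne
    have k₂ := k.2.resolve_left hne
    change (inf w y).snd = (inf x z).snd
    -- Since `θ ≤ α` here, the case distinction in `inf` sees only `α`-classes and comes out the
    -- same on both sides.
    have e₁ : α.r (w.fst ⊓ y.fst) w.fst ↔ α.r (x.fst ⊓ z.fst) x.fst :=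
      ⟨fun t => α.iseqv.trans (α.iseqv.symm m₁) (α.iseqv.trans t h₁),
        fun t => α.iseqv.trans m₁ (α.iseqv.trans t (α.iseqv.symm h₁))⟩
    have e₂ : α.r (w.fst ⊓ y.fst) y.fst ↔ α.r (x.fst ⊓ z.fst) z.fst :=
      ⟨fun t => α.iseqv.trans (α.iseqv.symm m₁) (α.iseqv.trans t k₁),
        fun t => α.iseqv.trans m₁ (α.iseqv.trans t (α.iseqv.symm k₁))⟩
    classical
    exact if_congr (by rw [h₂, k₂, e₁, e₂]) (by rw [h₂, k₂]) rfl
  sup {w x y z} h k := by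
    refine ⟨θ.sup h.1 k.1, or_iff_not_imp_left.2 fun hne => ?_⟩
    have h₁ := he hne h.1
    have k₁ := he hne k.1
    have m₁ := α.sup h₁ k₁
    have h₂ := h.2.resolve_left hne
    have k₂ := k.2.resolve_left hne
    change (sup w y).snd = (sup x z).snd
    have e₁ : α.r w.fst (w.fst ⊔ y.fst) ↔ α.r x.fst (x.fst ⊔ z.fst) :=
      ⟨fun t => α.iseqv.trans (α.iseqv.symm h₁) (α.iseqv.trans t m₁),
        fun t => α.iseqv.trans h₁ (α.iseqv.trans t (α.iseqv.symm m₁))⟩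
    have e₂ : α.r y.fst (w.fst ⊔ y.fst) ↔ α.r z.fst (x.fst ⊔ z.fst) :=
      ⟨fun t => α.iseqv.trans (α.iseqv.symm k₁) (α.iseqv.trans t m₁),
        fun t => α.iseqv.trans k₁ (α.iseqv.trans t (α.iseqv.symm m₁))⟩
    classical
    exact if_congr (by rw [h₂, k₂, e₁, e₂]) (by rw [h₂, k₂]) rfl

/-- The restriction of a congruence to the bottom copy of the base. -/
def base (Θ : LatticeCon (FibredProd α B)) : LatticeCon A where
  r a a' := Θ.r ⟨a, ⊥⟩ ⟨a', ⊥⟩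
  iseqv :=
    { refl _ := Θ.iseqv.refl _
      symm h := Θ.iseqv.symm h
      trans h k := Θ.iseqv.trans h k }
  inf h k := by simpa only [inf_mk_bot] using Θ.inf h k
  sup h k := by simpa only [mk_bot_sup_mk_bot] using Θ.sup h k

/-- The restriction of a congruence to the fibre over `a`. -/
def fibre (Θ : LatticeCon (FibredProd α B)) (a : A) : LatticeCon B where
  r b b' := Θ.r ⟨a, b⟩ ⟨a, b'⟩
  iseqv :=
    { refl _ := Θ.iseqv.refl _
      symm h := Θ.iseqv.symm h
      trans h k := Θ.iseqv.trans h k }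
  inf h k := by
    simpa only [mk_inf_mk_of_rel _ _ (α.iseqv.refl a), inf_idem] using Θ.inf h k
  sup h k := by
    simpa only [mk_sup_mk_of_rel _ _ (α.iseqv.refl a), sup_idem] using Θ.sup h k

/-- A congruence collapses the fibres if it identifies the bounds of each fibre. -/
def CollapsesFibres (Θ : LatticeCon (FibredProd α B)) : Prop :=
  ∀ a, Θ.r ⟨a, ⊥⟩ ⟨a, ⊤⟩

theorem base_r_of_r {Θ : LatticeCon (FibredProd α B)} {x y : FibredProd α B} (h : Θ.r x y) :
    (base Θ).r x.fst y.fst := by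
  have h₁ := Θ.inf h (Θ.iseqv.refl ⟨x.fst ⊔ y.fst, ⊥⟩)
  simp only [inf_mk_bot, inf_sup_self, inf_eq_left.2 (le_sup_right : y.fst ≤ x.fst ⊔ y.fst)] at h₁
  exact h₁

/-- Simplicity collapses the whole fibre over `a`; joining with `⟨x, ⊥⟩` moves it up over `x ⊔ a`,
and meeting with `⟨x, ⊤⟩` brings it down over `x`. -/
theorem collapsesFibres_of_fibre (hB : LatticeCon.IsSimpleLattice B)
    {Θ : LatticeCon (FibredProd α B)} {a : A} {b b' : B} (hb : b ≠ b')
    (h : Θ.r ⟨a, b⟩ ⟨a, b'⟩) : CollapsesFibres Θ := by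
  intro x
  have h₁ : Θ.r ⟨a, ⊥⟩ ⟨a, ⊤⟩ := hB (fibre Θ a) b b' hb h
  have h₂ := Θ.sup (Θ.iseqv.refl ⟨x, ⊥⟩) h₁
  rw [mk_bot_sup_mk_bot, sup_mk_top] at h₂
  have h₃ := Θ.inf (Θ.iseqv.refl ⟨x, ⊤⟩) h₂
  rw [inf_mk_bot, mk_inf_mk_of_le _ le_sup_left] at h₃
  simpa using h₃

theorem collapsesFibres_of_not_rel (hB : LatticeCon.IsSimpleLattice B)
    (hi : ∃ i : B, i ≠ ⊥ ∧ i ≠ ⊤) {Θ : LatticeCon (FibredProd α B)} {a a' : A}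
    (h : (base Θ).r a a') (hα : ¬ α.r a a') : CollapsesFibres Θ := by
  obtain ⟨i, hi₀, hi₁⟩ := hi
  rw [← LatticeCon.r_inf_sup_iff] at h hα
  have hle : a ⊓ a' ≤ a ⊔ a' := inf_le_sup
  generalize a ⊓ a' = c at *
  generalize a ⊔ a' = d at *
  -- Joining with `⟨c, i⟩` and with `⟨c, ⊤⟩` relates both to `⟨d, ⊤⟩`, hence to each other, within
  -- one fibre.
  have h₁ := Θ.sup h (Θ.iseqv.refl ⟨c, i⟩)
  rw [mk_sup_mk_of_le _ le_rfl, mk_bot_sup_mk_of_not_rel hle hα hi₀] at h₁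
  have h₂ := Θ.sup h (Θ.iseqv.refl ⟨c, ⊤⟩)
  simp only [sup_mk_top, sup_idem, sup_eq_left.2 hle] at h₂
  exact collapsesFibres_of_fibre hB hi₁ (Θ.iseqv.trans h₁ (Θ.iseqv.symm h₂))

theorem base_le (hB : LatticeCon.IsSimpleLattice B) (hi : ∃ i : B, i ≠ ⊥ ∧ i ≠ ⊤)
    (Θ : LatticeCon (FibredProd α B)) (h : ¬ CollapsesFibres Θ) : base Θ ≤ α := fun _ _ hr =>
  not_not.1 fun hα => h (collapsesFibres_of_not_rel hB hi hr hα)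

theorem r_iff (hB : LatticeCon.IsSimpleLattice B) (hi : ∃ i : B, i ≠ ⊥ ∧ i ≠ ⊤)
    (Θ : LatticeCon (FibredProd α B)) (x y : FibredProd α B) :
    Θ.r x y ↔ (base Θ).r x.fst y.fst ∧ (CollapsesFibres Θ ∨ x.snd = y.snd) := by
  obtain ⟨a, b⟩ := x
  obtain ⟨a', b'⟩ := y
  constructor
  · intro h
    refine ⟨base_r_of_r h, or_iff_not_imp_left.2 fun he => ?_⟩
    by_contra hb
    have hα : α.r a a' := base_le hB hi Θ he (base_r_of_r h)
    -- Within an `α`-class this join moves both points into one fibre without changing `b` and `b'`.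
    have h₁ := Θ.sup h (Θ.iseqv.refl ⟨a ⊔ a', ⊥⟩)
    have e₁ : α.r a (a ⊔ a') := by simpa using α.sup (α.iseqv.refl a) hα
    rw [mk_sup_mk_of_rel _ _ e₁,
      mk_sup_mk_of_rel _ _ (α.iseqv.trans (α.iseqv.symm hα) e₁)] at h₁
    simp only [sup_bot_eq, le_sup_left, le_sup_right, sup_of_le_right] at h₁
    exact he (collapsesFibres_of_fibre hB hb h₁)
  · rintro ⟨h, he⟩
    by_cases hc : CollapsesFibres Θ
    · have key : ∀ (c : A) (d : B), Θ.r ⟨c, ⊥⟩ ⟨c, d⟩ := by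
        intro c d
        have h₁ := Θ.inf (Θ.iseqv.refl ⟨c, d⟩) (hc c)
        rw [inf_mk_bot, mk_inf_mk_of_le _ le_rfl] at h₁
        simpa using h₁
      exact Θ.iseqv.trans (Θ.iseqv.symm (key a b)) (Θ.iseqv.trans h (key a' b'))
    · obtain rfl : b = b' := he.resolve_left hc
      have hα : α.r a a' := base_le hB hi Θ hc h
      -- This lifts the base relation to level `b`.
      have h₁ := Θ.sup h (Θ.iseqv.refl ⟨a ⊓ a', b⟩)
      have e₁ : α.r a (a ⊓ a') := by simpa using α.inf (α.iseqv.refl a) hα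
      rw [mk_sup_mk_of_rel _ _ e₁,
        mk_sup_mk_of_rel _ _ (α.iseqv.trans (α.iseqv.symm hα) e₁)] at h₁
      simpa using h₁

/-- The congruence lattice of a fibred product with simple fibres. -/
def conOrderIso [Nonempty A] (hB : LatticeCon.IsSimpleLattice B) (hi : ∃ i : B, i ≠ ⊥ ∧ i ≠ ⊤) :
    LatticeCon (FibredProd α B) ≃o {p : LatticeCon A × Prop // ¬ p.2 → p.1 ≤ α} where
  toFun Θ := ⟨(base Θ, CollapsesFibres Θ), base_le hB hi Θ⟩
  invFun p := con p.1.1 p.1.2 p.2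
  left_inv Θ := le_antisymm (fun _ _ => (r_iff hB hi Θ _ _).2) (fun _ _ => (r_iff hB hi Θ _ _).1)
  right_inv := by
    obtain ⟨i, hi₀, -⟩ := hi
    have hbt : (⊥ : B) ≠ ⊤ := fun h => hi₀ (le_bot_iff.1 (h ▸ le_top))
    rintro ⟨⟨θ, e⟩, he⟩
    refine Subtype.ext (Prod.ext ?_ ?_)
    · exact le_antisymm (fun a a' h => h.1) (fun a a' h => ⟨h, .inr rfl⟩)
    · refine propext ⟨fun h => ?_, fun h a => ⟨θ.iseqv.refl a, .inl h⟩⟩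
      exact (h (Classical.arbitrary A)).2.resolve_right hbt
  map_rel_iff' := by
    intro Θ Ψ
    refine ⟨fun h _ _ hr => ?_, fun h => ⟨fun a a' hr => h hr, fun hc a => h (hc a)⟩⟩
    rw [r_iff hB hi] at hr ⊢
    exact ⟨h.1 hr.1, hr.2.imp (fun k => h.2 k) id⟩

theorem isUniformLattice (hB : LatticeCon.IsSimpleLattice B) (hi : ∃ i : B, i ≠ ⊥ ∧ i ≠ ⊤)
    (hA : IsUniformLattice A) : IsUniformLattice (FibredProd α B) := by
  intro Θ
  rw [LatticeCon.isUniform_iff]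
  have key : ∀ x : FibredProd α B, Nonempty ({z // Θ.r z x} ≃
      {a // (base Θ).r a x.fst} × {b // CollapsesFibres Θ ∨ b = x.snd}) := fun x =>
    ⟨{  toFun z := (⟨z.1.fst, ((r_iff hB hi Θ _ _).1 z.2).1⟩,
          ⟨z.1.snd, ((r_iff hB hi Θ _ _).1 z.2).2⟩)
        invFun p := ⟨⟨p.1.1, p.2.1⟩, (r_iff hB hi Θ _ _).2 ⟨p.1.2, p.2.2⟩⟩
        left_inv _ := rfl
        right_inv _ := rfl }⟩
  intro x y
  obtain ⟨f⟩ := key x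
  obtain ⟨g⟩ := key y
  obtain ⟨s⟩ := Cardinal.eq.1 ((LatticeCon.isUniform_iff _).1 (hA (base Θ)) x.fst y.fst)
  have t : Nonempty ({b // CollapsesFibres Θ ∨ b = x.snd} ≃
      {b // CollapsesFibres Θ ∨ b = y.snd}) := by
    by_cases hc : CollapsesFibres Θ
    · exact ⟨Equiv.subtypeEquivRight fun b => by simp [hc]⟩
    · simp only [hc, false_or]
      exact ⟨Equiv.ofUnique _ _⟩
  obtain ⟨t⟩ := t
  exact Cardinal.eq.2 ⟨f.trans ((s.prodCongr t).trans g.symm)⟩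

instance instFinite [Finite A] [Finite B] : Finite (FibredProd α B) :=
  Finite.of_injective (fun x => (x.fst, x.snd)) fun _ _ h =>
    FibredProd.ext (congrArg Prod.fst h) (congrArg Prod.snd h)

end FibredProd

/-! ### A simple fibre -/

/-- The lattice of length two with three atoms. -/
inductive Diamond : Type
  | bot
  | atom (i : Fin 3)
  | top

namespace Diamond

instance instPartialOrder : PartialOrder Diamond where
  le x y := x = y ∨ x = bot ∨ y = top
  le_refl _ := .inl rfl
  le_trans x y z := by
    rintro (rfl | rfl | rfl) (rfl | h | rfl) <;> simp_all
  le_antisymm x y := by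
    rintro (rfl | rfl | rfl) (h | h | h) <;> simp_all

theorem le_def {x y : Diamond} : x ≤ y ↔ x = y ∨ x = bot ∨ y = top := Iff.rfl

open Classical in
noncomputable instance instLattice : Lattice Diamond where
  sup x y := if x = bot then y else if y = bot then x else if x = y then x else top
  inf x y := if x = top then y else if y = top then x else if x = y then x else bot
  le_sup_left x y := by simp only [le_def]; grind
  le_sup_right x y := by simp only [le_def]; grind
  sup_le x y z := by simp only [le_def]; grind
  inf_le_left x y := by simp only [le_def]; grind
  inf_le_right x y := by simp only [le_def]; grind
  le_inf x y z := by simp only [le_def]; grind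

instance instBoundedOrder : BoundedOrder Diamond where
  bot := bot
  top := top
  bot_le _ := .inr (.inl rfl)
  le_top _ := .inr (.inr rfl)

theorem atom_sup_atom {i j : Fin 3} (h : i ≠ j) : atom i ⊔ atom j = ⊤ := by
  refine (if_neg (by simp)).trans ((if_neg (by simp)).trans (if_neg (by simpa using h)))

theorem atom_inf_atom {i j : Fin 3} (h : i ≠ j) : atom i ⊓ atom j = ⊥ := by
  refine (if_neg (by simp)).trans ((if_neg (by simp)).trans (if_neg (by simpa using h)))

instance instFinite : Finite Diamond :=
  Finite.of_surjective
    (fun x : Option (Option (Fin 3)) => x.elim bot fun y => y.elim top atom) fun x =>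
    match x with
    | bot => ⟨none, rfl⟩
    | top => ⟨some none, rfl⟩
    | atom i => ⟨some (some i), rfl⟩

theorem isSimpleLattice : LatticeCon.IsSimpleLattice Diamond := by
  intro θ
  have h₀ : ∀ i j, i ≠ j → θ.r ⊥ (atom i) → θ.r (atom j) ⊤ := by
    intro i j hij h
    simpa [atom_sup_atom hij] using θ.sup h (θ.iseqv.refl (atom j))
  have h₁ : ∀ i j, i ≠ j → θ.r (atom i) ⊤ → θ.r ⊥ (atom j) := by
    intro i j hij h
    simpa [atom_inf_atom hij] using θ.inf h (θ.iseqv.refl (atom j))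
  have hne : ∀ i : Fin 3, ∃ j k, i ≠ j ∧ j ≠ k ∧ k ≠ i := by decide
  have h₂ : ∀ i, θ.r ⊥ (atom i) → θ.r ⊥ ⊤ := by
    intro i h
    obtain ⟨j, k, hij, hjk, hki⟩ := hne i
    -- The zigzag through the other two atoms returns to `atom i ~ ⊤`; this needs a third atom.
    exact θ.iseqv.trans h (h₀ k i hki (h₁ j k hjk (h₀ i j hij h)))
  have h₃ : ∀ i, θ.r (atom i) ⊤ → θ.r ⊥ ⊤ := by
    intro i h
    obtain ⟨j, k, hij, hjk, hki⟩ := hne i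
    exact h₂ j (h₁ i j hij h)
  have h₄ : ∀ i j, i ≠ j → θ.r (atom i) (atom j) → θ.r ⊥ ⊤ := by
    intro i j hij h
    refine h₃ j (θ.iseqv.symm ?_)
    simpa [atom_sup_atom hij] using θ.sup h (θ.iseqv.refl (atom j))
  rintro (_ | i | _) (_ | j | _) hxy h
  · exact absurd rfl hxy
  · exact h₂ j h
  · exact h
  · exact h₂ i (θ.iseqv.symm h)
  · exact h₄ i j (by simpa using hxy) h
  · exact h₃ i h
  · exact θ.iseqv.symm h
  · exact h₃ j (θ.iseqv.symm h)
  · exact absurd rfl hxy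

theorem exists_ne_bot_ne_top : ∃ i : Diamond, i ≠ ⊥ ∧ i ≠ ⊤ :=
  ⟨atom 0, Diamond.noConfusion, Diamond.noConfusion⟩

end Diamond

/-! ### Splitting off an atom, and the induction -/

/-- If `p` and `q` are disjoint and every element not above `p` lies below `q`, an element `d` of a
distributive lattice is determined by `p ⊔ d` and whether `p ≤ d`. -/
noncomputable def decompositionOrderIso {D : Type u} [DistribLattice D] [OrderBot D] {p q : D} (hpq : p ⊓ q = ⊥)
    (hp : p ≠ ⊥) (hq : ∀ d, ¬ p ≤ d → d ≤ q) :
    D ≃o {x : Set.Ici p × Prop // ¬ x.2 → x.1 ≤ ⟨p ⊔ q, le_sup_left⟩} := by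
  classical
  exact
  { toFun d := ⟨(⟨p ⊔ d, le_sup_left⟩, p ≤ d), fun h => sup_le_sup_left (hq d h) p⟩
    -- If `p ≰ d` then `d ≤ q`, so `(p ⊔ d) ⊓ q = d`.
    invFun x := if x.1.2 then x.1.1 else x.1.1 ⊓ q
    left_inv d := by
      by_cases h : p ≤ d
      · simp [h]
      · simp only [h, if_false]
        rw [inf_sup_right, hpq, bot_sup_eq, inf_eq_left.2 (hq d h)]
    right_inv := by
      rintro ⟨⟨⟨x, hx⟩, e⟩, he⟩
      have hx' : p ≤ x := hx
      by_cases h : e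
      · simp [h, hx']
      · have he' : x ≤ p ⊔ q := he h
        have : ¬ p ≤ q := fun h => hp (by rwa [inf_eq_left.2 h] at hpq)
        simp [h, this, sup_inf_left, hx', he']
    map_rel_iff' := by
      intro c d
      change (p ⊔ c ≤ p ⊔ d ∧ (p ≤ c → p ≤ d)) ↔ c ≤ d
      refine ⟨fun ⟨h₁, h₂⟩ => ?_, fun h => ⟨sup_le_sup_left h p, fun hc => hc.trans h⟩⟩
      by_cases hc : p ≤ c
      · simpa [hc, h₂ hc] using h₁
      · calc c ≤ (p ⊔ d) ⊓ q := le_inf (le_sup_right.trans h₁) (hq c hc)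
          _ = d ⊓ q := by rw [inf_sup_right, hpq, bot_sup_eq]
          _ ≤ d := inf_le_left }

theorem exists_uniform_lattice (n : ℕ) : ∀ (D : Type u) [DistribLattice D] [Finite D] [Nonempty D],
    Nat.card D = n → ∃ (L : Type u) (_ : Lattice L), Finite L ∧ Nonempty L ∧
      Nonempty (LatticeCon L ≃o D) ∧ IsUniformLattice L := by
  induction n using Nat.strong_induction_on with
  | _ n ih =>
  intro D _ _ _ hn
  have := Fintype.ofFinite D
  let _ : BoundedOrder D := Fintype.toBoundedOrder D
  rcases subsingleton_or_nontrivial D with hD | hD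
  · have hcon : Subsingleton (LatticeCon PUnit.{u + 1}) :=
      ⟨fun θ ψ => le_antisymm (fun x _ _ => ψ.iseqv.refl x) (fun x _ _ => θ.iseqv.refl x)⟩
    refine ⟨PUnit, inferInstance, inferInstance, inferInstance, ⟨?_⟩, fun θ => ?_⟩
    · exact
      { toFun _ := ⊥
        invFun _ := ⊥
        left_inv _ := Subsingleton.elim _ _
        right_inv _ := Subsingleton.elim _ _
        map_rel_iff' := by
          intro a b
          simp [Subsingleton.elim a b] }
    · exact (LatticeCon.isUniform_iff θ).2 fun x y => by rw [Subsingleton.elim x y]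
  · obtain ⟨p, hp⟩ := IsAtomic.exists_atom D
    obtain ⟨q, hpq, hq⟩ : ∃ q, p ⊓ q = ⊥ ∧ ∀ d, ¬ p ≤ d → d ≤ q := by
      classical
      -- Every element not above the atom `p` is disjoint from it, and by distributivity so is their
      -- join.
      refine ⟨(Finset.univ.filter fun d => ¬ p ≤ d).sup id, ?_, fun d hd => ?_⟩
      · rw [Finset.sup_inf_distrib_left]
        refine (Finset.sup_eq_bot_iff _ _).2 fun d hd => ?_
        exact (hp.not_le_iff_disjoint.1 (by simpa using hd)).eq_bot
      · exact Finset.le_sup (f := id) (by simpa using hd)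
    have hlt : Nat.card (Set.Ici p) < n := by
      rw [← hn]
      exact Finite.card_subtype_lt (x := ⊥) fun h => hp.1 (le_bot_iff.1 h)
    obtain ⟨A, _, hfin, hne, ⟨f⟩, hA⟩ := ih _ hlt (Set.Ici p) rfl
    let α : LatticeCon A := f.symm ⟨p ⊔ q, le_sup_left⟩
    refine ⟨FibredProd α Diamond, inferInstance, inferInstance, hne.map fun a => ⟨a, ⊥⟩, ⟨?_⟩,
      FibredProd.isUniformLattice Diamond.isSimpleLattice Diamond.exists_ne_bot_ne_top hA⟩
    refine (FibredProd.conOrderIso Diamond.isSimpleLattice Diamond.exists_ne_bot_ne_top).trans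
      (OrderIso.trans ?_ (decompositionOrderIso hpq hp.1 hq).symm)
    exact
    { toFun x := ⟨(f x.1.1, x.1.2), fun h => f.le_symm_apply.1 (x.2 h)⟩
      invFun x := ⟨(f.symm x.1.1, x.1.2), fun h => f.symm.monotone (x.2 h)⟩
      left_inv x := by simp
      right_inv x := by simp
      map_rel_iff' := by
        intro x y
        exact and_congr f.le_iff_le Iff.rfl }

theorem theoremT :
    (∀ (D : Type u) [DistribLattice D] [Finite D] [Nonempty D],
      ∃ (L : Type u) (_ : Lattice L), Finite L ∧ Nonempty L ∧
        Nonempty (LatticeCon L ≃o D) ∧ IsUniformLattice L ∧ IsRegularLattice L) ∧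
    (∀ (L : Type v) [Lattice L] [Finite L], IsUniformLattice L → IsRegularLattice L) := by
  refine ⟨fun D _ _ _ => ?_, fun L _ _ h => h.isRegularLattice⟩
  obtain ⟨L, _, hfin, hne, hiso, hL⟩ := exists_uniform_lattice _ D rfl
  exact ⟨L, _, hfin, hne, hiso, hL, hL.isRegularLattice⟩
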